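/- For $n\ge 1$ let $\mathcal U_n$ be the strip with upper boundary vertices $0^{(k)}$ and lower boundary vertices $1^{(k)},\dots,n^{(k)}$ ($k\in\mathbb Z$, arranged from left to right by increasing $k$; write $(i+ln)^{(k)}=i^{(k+l)}$). An arc of $\mathcal U_n$ is, up to isotopy, either a peripheral arc joining two lower vertices that are neither equal nor neighbours, or a bridging arc joining $i^{(k)}$ with $0^{(k)}$ ($1\le i\le n$). A triangulation is a maximal collection of pairwise non-crossing arcs; the regions into which it divides the strip are called triangles (a region may have more than one vertex on the upper boundary; these then count as one corner). A triangulation $\mathcal T$ is $n$-periodic if it is covered by the horizontal translates of an $(n+3)$-gon with vertices $0^{(k)},0^{(k+1)},i^{(k)},(i+1)^{(k)},\dots,(i+n)^{(k)}=i^{(k+1)}$ whose sides $0^{(k)}i^{(k)}$ and $0^{(k+1)}i^{(k+1)}$ are in $\mathcal T$. Let $\mathcal T$ be an $n$-periodic triangulation of $\mathcal U_n$ and let $r$ be the number of its bridging arcs up to translation by multiples of $n$; then $1\le r\le n$. (Frieze.) For $i\in\mathbb Z$ let $a_i$ be the number of triangles of $\mathcal T$ incident with the lower vertex $i^{(0)}$.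 There is an infinite frieze $(m_{ij})_{i,j\in\mathbb Z,\ j-i\ge -2}$ associated to $\mathcal T$, i.e. an array of integers with $m_{i,i-2}=0$, $m_{i,i-1}=1$, $m_{ij}>0$ for $j\ge i$, $m_{ij}m_{i+1,j+1}-m_{i+1,j}m_{i,j+1}=1$ for $j\ge i-1$, and $m_{ii}=a_i$ for all $i$. (Labels.) Start at an upper vertex $v=0^{(c)}$: give $v$, and with it every upper vertex, the label $0$, and give label $1$ to every lower vertex joined with $v$ by an arc of $\mathcal T$; then repeatedly, whenever two corners of a triangle of $\mathcal T$ have a label and the third has none, give the third one the sum of the two labels. This gives every lower vertex $i^{(k)}$ ($1\le i\le n$) exactly one label $n_i$, which depends neither on $k$ nor on $c$. Then any frieze $(m_{ij})$ associated to $\mathcal T$ is $n$-periodic, $m_{ij}=m_{i+n,j+n}$ for $i\le j$, and $n$-arithmetic: for all $i\in\mathbb Z$ and $k\in\{1,\dots,n\}$, with the common differences $d_{ik}:=m_{i,(i+k-3)+n}-m_{i,i+k-3}$, $$m_{i,(i+k-3)+(l+1)n}-m_{i,(i+k-3)+ln}=d_{ik}\qquad\text{for all } l\ge 0,$$ and $$d_{ik}=r\,n_{i-1}\,n_{i+k-2},$$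 where the indices $i-1$ and $i+k-2$ are reduced modulo $n$. -/

import Mathlib

namespace Strip

/-- The vertices of the strip `U_n`. The lower vertex `i^(k)` (with `1 ≤ i ≤ n`) is
`lower (i + k * n)`, so that `(i + l n)^(k) = i^(k+l)`; the upper vertex `0^(k)` is `upper k`. -/
inductive Vertex where
  | lower (p : ℤ)
  | upper (k : ℤ)

/-- The superscript `k` of the lower vertex `i^(k) = lower (i + k * n)`, `1 ≤ i ≤ n`. -/
def level (n : ℕ) (p : ℤ) : ℤ := (p - 1) / (n : ℤ)

/-- Arcs of the strip, up to isotopy (hence given by their endpoints). A peripheral arc joins two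
lower vertices that are neither equal nor neighbours, the left one being written first. A bridging
arc joins the lower vertex `p` with the upper vertex of the same superscript `level n p`. -/
inductive Arc where
  | peripheral (p q : ℤ) (h : p + 2 ≤ q)
  | bridging (p : ℤ)

/-- Two arcs cross if they intersect (whatever the representatives) in the interior of the strip.
Two bridging arcs never do, since the superscript is a monotone function of the lower vertex. -/
def Arc.Crosses : Arc → Arc → Prop
  | .peripheral a b _, .peripheral c d _ => (a < c ∧ c < b ∧ b < d) ∨ (c < a ∧ a < d ∧ d < b)
  | .peripheral a b _, .bridging p => a < p ∧ p < b
  | .bridging p, .peripheral a b _ => a < p ∧ p < b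
  | .bridging _, .bridging _ => False

/-- A triangulation: a maximal collection of pairwise non-crossing arcs. -/
def IsTriangulation (T : Set Arc) : Prop :=
  Maximal (fun S : Set Arc => S.Pairwise fun α β => ¬ α.Crosses β) T

/-- Horizontal translation by `t` lower vertices (used for multiples `t` of `n` only). -/
def Arc.translate (t : ℤ) : Arc → Arc
  | .peripheral p q h => .peripheral (p + t) (q + t) (by omega)
  | .bridging p => .bridging (p + t)

/-- The arc lies in the closed `(n+3)`-gon with lower vertices `i, i + 1, …, i + n` and upper
vertices `0^(k), 0^(k+1)`, where `k = level n i`. -/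
def Arc.InPolygon (n : ℕ) (i : ℤ) : Arc → Prop
  | .peripheral p q _ => i ≤ p ∧ q ≤ i + n
  | .bridging p => i ≤ p ∧ p ≤ i + n

/-- The `(n+3)`-gon with lower vertices `i, …, i + n`, bounded on the left and on the right by the
bridging arcs at `i` and at `i + n`, is a fundamental domain for `T`: these two arcs are in `T`, and
`T` is covered by the horizontal translates of the part of `T` in this polygon. -/
def IsFundamentalDomain (n : ℕ) (T : Set Arc) (i : ℤ) : Prop :=
  Arc.bridging i ∈ T ∧ Arc.bridging (i + n) ∈ T ∧
    T = {α | ∃ β ∈ T, β.InPolygon n i ∧ ∃ t : ℤ, α = β.translate (t * n)}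

/-- `n`-periodic triangulations of the strip `U_n`. -/
def IsPeriodicTriangulation (n : ℕ) (T : Set Arc) : Prop :=
  IsTriangulation T ∧ ∃ i : ℤ, IsFundamentalDomain n T i

/-- The number of bridging arcs of `T` up to translation by multiples of `n`. -/
noncomputable def bridgingCount (n : ℕ) (T : Set Arc) : ℕ :=
  ((fun p : ℤ => (p : ZMod n)) '' {p : ℤ | Arc.bridging p ∈ T}).ncard

/-- The lower vertices `p < q` are joined by a boundary segment or by an arc of `T`. -/
def Joined (T : Set Arc) (p q : ℤ) : Prop :=
  q = p + 1 ∨ ∃ h : p + 2 ≤ q, Arc.peripheral p q h ∈ T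

/-- Names for the regions ("triangles") into which a triangulation divides the strip:
`lower a b c` has the three lower vertices `a < b < c`; `upper a b` has the two lower vertices
`a < b` and is bounded by the bridging arcs at `a` and `b`, by the side joining `a` and `b`, and by
the (possibly degenerate) part of the upper boundary between the ends of the two bridging arcs. -/
inductive Triangle where
  | lower (a b c : ℤ)
  | upper (a b : ℤ)

/-- The region is one of the triangles of `T`. -/
def Triangle.MemOf (T : Set Arc) : Triangle → Prop
  | .lower a b c => a < b ∧ b < c ∧ Joined T a b ∧ Joined T b c ∧ Joined T a c
  | .upper a b => Joined T a b ∧ Arc.bridging a ∈ T ∧ Arc.bridging b ∈ T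

/-- The lower vertex `p` is incident with the triangle. -/
def Triangle.Incident (p : ℤ) : Triangle → Prop
  | .lower a b c => p = a ∨ p = b ∨ p = c
  | .upper a b => p = a ∨ p = b

/-- The quiddity sequence: the number of triangles of `T` incident with the lower vertex `p`. -/
noncomputable def quiddity (T : Set Arc) (p : ℤ) : ℕ :=
  {τ : Triangle | τ.MemOf T ∧ τ.Incident p}.ncard

/-- `w₁, w₂, w₃` are, in some order, the corners of the triangle. A four-sided region counts as a
triangle, with either one of its two upper vertices as the third corner. -/
def Triangle.Corners (n : ℕ) (w₁ w₂ w₃ : Vertex) : Triangle → Prop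
  | .lower a b c => [w₁, w₂, w₃].Perm [.lower a, .lower b, .lower c]
  | .upper a b => ∃ k : ℤ, level n a ≤ k ∧ k ≤ level n b ∧
      [w₁, w₂, w₃].Perm [.lower a, .lower b, .upper k]

/-- `v` and `w` are joined by an arc of `T` or by a segment of the lower boundary. Segments of the
upper boundary are left out: all upper vertices share one label anyway. -/
def Adjacent (n : ℕ) (T : Set Arc) : Vertex → Vertex → Prop
  | .lower p, .lower q => Joined T p q ∨ Joined T q p
  | .lower p, .upper k => Arc.bridging p ∈ T ∧ k = level n p
  | .upper k, .lower p => Arc.bridging p ∈ T ∧ k = level n p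
  | .upper _, .upper _ => False

/-- The first labels of the labeling algorithm with starting vertex `v`: `v` gets `0`, the
neighbours of `v` get `1`, and a label given to one upper vertex is given to all of them. -/
inductive InitialLabel (n : ℕ) (T : Set Arc) (v : Vertex) : Vertex → ℕ → Prop
  | start : InitialLabel n T v v 0
  | neighbor {w : Vertex} : Adjacent n T v w → InitialLabel n T v w 1
  | upper {k k' : ℤ} {x : ℕ} : InitialLabel n T v (.upper k) x → InitialLabel n T v (.upper k') x

/-- One round of the algorithm, `L w x` meaning that `w` already has the label `x`: if two corners
of a triangle of `T` have labels and the third one has none, then the third one gets their sum;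
a label given to one upper vertex is given to all of them. -/
inductive NextLabel (n : ℕ) (T : Set Arc) (L : Vertex → ℕ → Prop) : Vertex → ℕ → Prop
  | keep {w : Vertex} {x : ℕ} : L w x → NextLabel n T L w x
  | add {τ : Triangle} {w₁ w₂ w₃ : Vertex} {x y : ℕ} : τ.MemOf T → τ.Corners n w₁ w₂ w₃ →
      L w₁ x → L w₂ y → (∀ z, ¬ L w₃ z) → NextLabel n T L w₃ (x + y)
  | upper {k k' : ℤ} {x : ℕ} : NextLabel n T L (.upper k) x → NextLabel n T L (.upper k') x

/-- The labels present after `s` rounds. -/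
def LabelAfter (n : ℕ) (T : Set Arc) (v : Vertex) : ℕ → Vertex → ℕ → Prop
  | 0 => InitialLabel n T v
  | s + 1 => NextLabel n T (LabelAfter n T v s)

/-- The labeling algorithm with starting vertex `v` attaches the label `x` to `w`. -/
def IsLabel (n : ℕ) (T : Set Arc) (v w : Vertex) (x : ℕ) : Prop :=
  ∃ s : ℕ, LabelAfter n T v s w x

end Strip

namespace Frieze

/-- Infinite friezes `(m i j)`, `j - i ≥ -2`; the values `m i j` with `j < i - 2` are irrelevant. -/
structure IsInfiniteFrieze (m : ℤ → ℤ → ℤ) : Prop where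
  zero : ∀ i, m i (i - 2) = 0
  one : ∀ i, m i (i - 1) = 1
  pos : ∀ i j, i ≤ j → 0 < m i j
  unimodular : ∀ i j, i - 1 ≤ j → m i j * m (i + 1) (j + 1) - m (i + 1) j * m i (j + 1) = 1

/-- The frieze is `n`-periodic. -/
def IsPeriodic (n : ℕ) (m : ℤ → ℤ → ℤ) : Prop :=
  ∀ i j, i ≤ j → m i j = m (i + n) (j + n)

/-- The difference `d_ik = m_{i,(i+k-3)+r} - m_{i,i+k-3}`. -/
def commonDifference (r : ℕ) (m : ℤ → ℤ → ℤ) (i k : ℤ) : ℤ :=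
  m i ((i + k - 3) + r) - m i (i + k - 3)

/-- The frieze is `r`-arithmetic. -/
def IsArithmetic (r : ℕ) (m : ℤ → ℤ → ℤ) : Prop :=
  ∀ i k : ℤ, 1 ≤ k → k ≤ r → ∀ l : ℕ,
    m i ((i + k - 3) + (l + 1) * r) - m i ((i + k - 3) + l * r) = commonDifference r m i k

/-- `m` is an infinite frieze whose quiddity row is the quiddity sequence of `T`. -/
def IsAssociated (T : Set Strip.Arc) (m : ℤ → ℤ → ℤ) : Prop :=
  IsInfiniteFrieze m ∧ ∀ i, m i i = Strip.quiddity T i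

end Frieze

namespace Strip

/-! The triangulation is realized by integer vectors `v p = (x p, L p)` at the lower vertices, with
the upper boundary in direction `(1, 0)`. Number the bridging arcs from left to right; the foot of
the arc with number `f` gets the vector `(f, 1)`, and the middle corner of a triangle with three
lower corners gets the sum of the vectors at the outer two. Every lower vertex without a bridging
arc is the middle corner of exactly one triangle, so this defines all vectors (`exists_base`,
`base_unique`, `exists_additive`).

Counting the triangles at `p` gives `v (p-1) + v (p+1) = a_p • v p`
(`IsTriangulation.quiddity_mul`). Hence neighbouring vectors have determinant 1, and `m_ij = det (v
(i-1), v (j+1))` is an infinite frieze with quiddity row `a_i` (`isAssociated`). A frieze is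
determined by its quiddity row (`eq_of_diag`), so this is the only one associated to `T`.

The second coordinate `L` is the label found by the algorithm (`isLabel_iff`). Translation by `n`
shifts the numbering of the bridging arcs by `r`, so it acts on the vectors as the shear `(x, L) ↦
(x + r L, L)`. The shear preserves determinants, which is periodicity; applied to the second vector
only, it raises the determinant by `r L_p L_q`, which is arithmeticity together with the formula for
the differences. -/

/-! ### Local structure of a triangulation -/

theorem Arc.Crosses.symm {α β : Arc} (h : α.Crosses β) : β.Crosses α := by
  cases α <;> cases β <;> simp only [Arc.Crosses] at h ⊢ <;> omega

theorem Joined.lt {T : Set Arc} {a b : ℤ} (h : Joined T a b) : a < b := by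
  rcases h with h | ⟨h, -⟩ <;> omega

theorem joined_succ (T : Set Arc) (p : ℤ) : Joined T p (p + 1) := Or.inl rfl

theorem IsTriangulation.not_crosses {T : Set Arc} (hT : IsTriangulation T) {α β : Arc}
    (hα : α ∈ T) (hβ : β ∈ T) : ¬ α.Crosses β := by
  by_cases h : α = β
  · subst h
    cases α <;> simp [Arc.Crosses]
  · exact hT.prop hα hβ h

theorem IsTriangulation.mem_of_not_crosses {T : Set Arc} (hT : IsTriangulation T) {α : Arc}
    (h : ∀ β ∈ T, ¬ α.Crosses β) : α ∈ T := by
  refine hT.le_of_ge (y := insert α T) ?_ (Set.subset_insert α T) (Set.mem_insert α T)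
  exact hT.prop.insert fun β hβ _ => ⟨h β hβ, fun hc => h β hβ hc.symm⟩

theorem IsTriangulation.joined_not_crosses {T : Set Arc} (hT : IsTriangulation T) {a b c d : ℤ}
    (h : Joined T a b) (h' : Joined T c d) (hac : a < c) (hcb : c < b) (hbd : b < d) : False := by
  rcases h with h | ⟨h₁, h₂⟩
  · omega
  rcases h' with h' | ⟨h₁', h₂'⟩
  · omega
  exact hT.not_crosses h₂ h₂' (Or.inl ⟨hac, hcb, hbd⟩)

theorem IsTriangulation.joined_not_crosses_bridging {T : Set Arc} (hT : IsTriangulation T)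
    {a b p : ℤ} (h : Joined T a b) (hp : Arc.bridging p ∈ T) (hap : a < p) (hpb : p < b) :
    False := by
  rcases h with h | ⟨h₁, h₂⟩
  · omega
  exact hT.not_crosses h₂ hp ⟨hap, hpb⟩

theorem IsTriangulation.joined_of_not_crosses {T : Set Arc} (hT : IsTriangulation T) {a b : ℤ}
    (hab : a < b)
    (h₁ : ∀ c d, Joined T c d → a < c → c < b → b < d → False)
    (h₂ : ∀ c d, Joined T c d → c < a → a < d → d < b → False)
    (h₃ : ∀ p, Arc.bridging p ∈ T → a < p → p < b → False) : Joined T a b := by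
  by_cases h : b = a + 1
  · exact Or.inl h
  refine Or.inr ⟨by omega, hT.mem_of_not_crosses ?_⟩
  rintro (⟨c, d, hcd⟩ | p) hβ
  · rintro (⟨h, h', h''⟩ | ⟨h, h', h''⟩)
    · exact h₁ c d (Or.inr ⟨hcd, hβ⟩) h h' h''
    · exact h₂ c d (Or.inr ⟨hcd, hβ⟩) h h' h''
  · rintro ⟨h, h'⟩
    exact h₃ p hβ h h'

/-- The lower vertices `a < b < c` are the corners of a triangle of `T`. -/
def IsLowerTriangle (T : Set Arc) (a b c : ℤ) : Prop :=
  Joined T a b ∧ Joined T b c ∧ Joined T a c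

theorem memOf_lower_iff {T : Set Arc} {a b c : ℤ} :
    (Triangle.lower a b c).MemOf T ↔ IsLowerTriangle T a b c :=
  ⟨fun h => h.2.2, fun h => ⟨h.1.lt, h.2.1.lt, h⟩⟩

/-- The apex is the farthest neighbour `b` of `a` short of `c`: an arc crossing `b c` would cross `a
c` or `a b`, or would start at `a` and reach farther than `b`. By maximality `b c` is then in `T`.
-/
theorem IsTriangulation.exists_apex {T : Set Arc} (hT : IsTriangulation T) {a c : ℤ}
    (hac : Joined T a c) (h : a + 2 ≤ c) : ∃ b, IsLowerTriangle T a b c := by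
  obtain ⟨b, ⟨hab, hbc⟩, hmax⟩ := Int.exists_greatest_of_bdd
    (P := fun b => Joined T a b ∧ b < c) ⟨c, fun z hz => hz.2.le⟩
    ⟨a + 1, joined_succ T a, by omega⟩
  refine ⟨b, hab, hT.joined_of_not_crosses hbc ?_ ?_ ?_, hac⟩
  · intro d e hde h₁ h₂ h₃
    exact hT.joined_not_crosses hac hde (hab.lt.trans h₁) h₂ h₃
  · intro d e hde h₁ h₂ h₃
    rcases lt_trichotomy d a with h₄ | rfl | h₄
    · exact hT.joined_not_crosses hde hac h₄ (hab.lt.trans h₂) h₃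
    · exact absurd (hmax e ⟨hde, h₃⟩) (by omega)
    · exact hT.joined_not_crosses hab hde h₄ h₁ h₂
  · intro p hp h₁ h₂
    exact hT.joined_not_crosses_bridging hac hp (hab.lt.trans h₁) h₂

theorem IsTriangulation.apex_unique {T : Set Arc} (hT : IsTriangulation T) {a b b' c : ℤ}
    (h : IsLowerTriangle T a b c) (h' : IsLowerTriangle T a b' c) : b = b' := by
  by_contra hne
  rcases lt_or_gt_of_ne hne with hlt | hlt
  · exact hT.joined_not_crosses h'.1 h.2.1 h.1.lt hlt h'.2.1.lt
  · exact hT.joined_not_crosses h.1 h'.2.1 h'.1.lt hlt h.2.1.lt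

theorem IsTriangulation.base_unique {T : Set Arc} (hT : IsTriangulation T) {a a' b c c' : ℤ}
    (h : IsLowerTriangle T a b c) (h' : IsLowerTriangle T a' b c') : a = a' ∧ c = c' := by
  obtain ⟨h₁, h₂, h₃⟩ := h
  obtain ⟨h₁', h₂', h₃'⟩ := h'
  have := h₁.lt; have := h₂.lt; have := h₁'.lt; have := h₂'.lt
  constructor
  · by_contra hne
    rcases lt_or_gt_of_ne hne with hlt | hlt
    · exact hT.joined_not_crosses h₁ h₃' hlt ‹_› ‹_›
    · exact hT.joined_not_crosses h₁' h₃ hlt ‹_› ‹_›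
  · by_contra hne
    rcases lt_or_gt_of_ne hne with hlt | hlt
    · exact hT.joined_not_crosses h₃ h₂' ‹_› ‹_› hlt
    · exact hT.joined_not_crosses h₃' h₂ ‹_› ‹_› hlt

/-- Among any `n` consecutive lower vertices there is one with a bridging arc. -/
def HasBridging (n : ℕ) (T : Set Arc) : Prop :=
  ∀ a : ℤ, ∃ q, Arc.bridging q ∈ T ∧ a < q ∧ q ≤ a + n

theorem HasBridging.exists_lt {n : ℕ} {T : Set Arc} (hB : HasBridging n T) (p : ℤ) :
    ∃ q, Arc.bridging q ∈ T ∧ q < p := by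
  obtain ⟨q, hq, -, h⟩ := hB (p - n - 1)
  exact ⟨q, hq, by omega⟩

theorem HasBridging.exists_gt {n : ℕ} {T : Set Arc} (hB : HasBridging n T) (p : ℤ) :
    ∃ q, Arc.bridging q ∈ T ∧ p < q := by
  obtain ⟨q, hq, h, -⟩ := hB p
  exact ⟨q, hq, h⟩

/-- Bridging arcs on both sides bound the neighbours of `p`, so there are outermost ones `a` and
`c`. An arc crossing `a c` would cross `a p` or `p c`, or end at `p`; the latter is excluded by
extremality for peripheral arcs and by `hp` for the bridging one. -/
theorem IsTriangulation.exists_base {n : ℕ} {T : Set Arc} (hT : IsTriangulation T)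
    (hB : HasBridging n T) {p : ℤ} (hp : Arc.bridging p ∉ T) :
    ∃ a c, IsLowerTriangle T a p c := by
  obtain ⟨q, hq, hqp⟩ := hB.exists_lt p
  obtain ⟨q', hq', hqp'⟩ := hB.exists_gt p
  obtain ⟨a, hap, hmin⟩ := Int.exists_least_of_bdd (P := fun a => Joined T a p)
    ⟨q, fun z hz => not_lt.1 fun h => hT.joined_not_crosses_bridging hz hq h hqp⟩
    ⟨p - 1, Or.inl (by omega)⟩
  obtain ⟨c, hpc, hmax⟩ := Int.exists_greatest_of_bdd (P := fun c => Joined T p c)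
    ⟨q', fun z hz => not_lt.1 fun h => hT.joined_not_crosses_bridging hz hq' hqp' h⟩
    ⟨p + 1, joined_succ T p⟩
  refine ⟨a, c, hap, hpc, hT.joined_of_not_crosses (hap.lt.trans hpc.lt) ?_ ?_ ?_⟩
  · intro d e hde h₁ h₂ h₃
    rcases lt_trichotomy d p with h₄ | rfl | h₄
    · exact hT.joined_not_crosses hap hde h₁ h₄ (hpc.lt.trans h₃)
    · exact absurd (hmax e hde) (by omega)
    · exact hT.joined_not_crosses hpc hde h₄ h₂ h₃
  · intro d e hde h₁ h₂ h₃
    rcases lt_trichotomy e p with h₄ | rfl | h₄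
    · exact hT.joined_not_crosses hde hap h₁ h₂ h₄
    · exact absurd (hmin d hde) (by omega)
    · exact hT.joined_not_crosses hde hpc (h₁.trans hap.lt) h₄ h₃
  · intro s hs h₁ h₂
    rcases lt_trichotomy s p with h₄ | rfl | h₄
    · exact hT.joined_not_crosses_bridging hap hs h₁ h₄
    · exact hp hs
    · exact hT.joined_not_crosses_bridging hpc hs h₄ h₂

theorem IsLowerTriangle.not_bridging {T : Set Arc} (hT : IsTriangulation T) {a p c : ℤ}
    (h : IsLowerTriangle T a p c) : Arc.bridging p ∉ T :=
  fun hp => hT.joined_not_crosses_bridging h.2.2 hp h.1.lt h.2.1.lt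

theorem IsTriangulation.joined_sub_le {n : ℕ} {T : Set Arc} (hT : IsTriangulation T)
    (hB : HasBridging n T) {a c : ℤ} (h : Joined T a c) : c - a ≤ n := by
  obtain ⟨q, hq, h₁, h₂⟩ := hB a
  have := mt (hT.joined_not_crosses_bridging h hq h₁) not_false
  omega

/-- The lower vertices `a < b` carry consecutive bridging arcs of `T`. -/
def IsUpperTriangle (T : Set Arc) (a b : ℤ) : Prop :=
  Joined T a b ∧ Arc.bridging a ∈ T ∧ Arc.bridging b ∈ T

theorem IsTriangulation.isUpperTriangle {T : Set Arc} (hT : IsTriangulation T) {a b : ℤ}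
    (hab : a < b) (ha : Arc.bridging a ∈ T) (hb : Arc.bridging b ∈ T)
    (h : ∀ p, Arc.bridging p ∈ T → a < p → p < b → False) : IsUpperTriangle T a b :=
  ⟨hT.joined_of_not_crosses hab
    (fun _ _ hcd _ h₂ h₃ => hT.joined_not_crosses_bridging hcd hb h₂ h₃)
    (fun _ _ hcd h₁ h₂ _ => hT.joined_not_crosses_bridging hcd ha h₁ h₂) h, ha, hb⟩

theorem IsTriangulation.exists_next {n : ℕ} {T : Set Arc} (hT : IsTriangulation T)
    (hB : HasBridging n T) {p : ℤ} (hp : Arc.bridging p ∈ T) : ∃ q, IsUpperTriangle T p q := by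
  obtain ⟨q, ⟨hq, hpq⟩, hmin⟩ := Int.exists_least_of_bdd
    (P := fun q => Arc.bridging q ∈ T ∧ p < q) ⟨p, fun z hz => hz.2.le⟩ (hB.exists_gt p)
  exact ⟨q, hT.isUpperTriangle hpq hp hq fun s hs h₁ h₂ => absurd (hmin s ⟨hs, h₁⟩) (by omega)⟩

theorem IsTriangulation.exists_prev {n : ℕ} {T : Set Arc} (hT : IsTriangulation T)
    (hB : HasBridging n T) {p : ℤ} (hp : Arc.bridging p ∈ T) : ∃ q, IsUpperTriangle T q p := by
  obtain ⟨q, ⟨hq, hpq⟩, hmax⟩ := Int.exists_greatest_of_bdd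
    (P := fun q => Arc.bridging q ∈ T ∧ q < p) ⟨p, fun z hz => hz.2.le⟩ (hB.exists_lt p)
  exact ⟨q, hT.isUpperTriangle hpq hq hp fun s hs h₁ h₂ => absurd (hmax s ⟨hs, h₂⟩) (by omega)⟩

theorem IsTriangulation.next_unique {T : Set Arc} (hT : IsTriangulation T) {p q q' : ℤ}
    (h : IsUpperTriangle T p q) (h' : IsUpperTriangle T p q') : q = q' := by
  by_contra hne
  rcases lt_or_gt_of_ne hne with hlt | hlt
  · exact hT.joined_not_crosses_bridging h'.1 h.2.2 h.1.lt hlt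
  · exact hT.joined_not_crosses_bridging h.1 h'.2.2 h'.1.lt hlt

theorem IsTriangulation.prev_unique {T : Set Arc} (hT : IsTriangulation T) {p q q' : ℤ}
    (h : IsUpperTriangle T q p) (h' : IsUpperTriangle T q' p) : q = q' := by
  by_contra hne
  rcases lt_or_gt_of_ne hne with hlt | hlt
  · exact hT.joined_not_crosses_bridging h.1 h'.2.1 hlt h'.1.lt
  · exact hT.joined_not_crosses_bridging h'.1 h.2.1 hlt h.1.lt

/-! ### Recursion from the bridging arcs inwards -/

/-- Data for recursion over the lower vertices, from the bridging arcs inwards. -/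
theorem IsTriangulation.exists_rank {n : ℕ} {T : Set Arc} (hT : IsTriangulation T)
    (hB : HasBridging n T) :
    ∃ μ : ℤ → ℕ, ∀ a p c, IsLowerTriangle T a p c → μ a < μ p ∧ μ c < μ p := by
  classical
  choose! l r h using fun p (hp : Arc.bridging p ∉ T) => hT.exists_base hB hp
  -- Bases have width at most `n`, so vertices without a bridging arc have positive rank. If an end
  -- of the base of `p` has a base of its own, that base contains the base of `p` strictly, hence
  -- has smaller rank.
  refine ⟨fun p => if Arc.bridging p ∈ T then 0 else (n + 1 - (r p - l p)).toNat, ?_⟩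
  intro a p c hp
  have hpB := hp.not_bridging hT
  obtain ⟨hl, hr⟩ := hT.base_unique (h p hpB) hp
  have hw := hT.joined_sub_le hB hp.2.2
  have := hp.1.lt
  have := hp.2.1.lt
  simp only [if_neg hpB, hl, hr]
  constructor
  · split_ifs with ha
    · omega
    · obtain ⟨h₁, h₂, h₃⟩ := h a ha
      have := hT.joined_sub_le hB h₃
      have := mt (hT.joined_not_crosses h₃ hp.2.2 h₁.lt h₂.lt) not_false
      have := h₁.lt
      omega
  · split_ifs with hc
    · omega
    · obtain ⟨h₁, h₂, h₃⟩ := h c hc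
      have := hT.joined_sub_le hB h₃
      have := mt (fun h => hT.joined_not_crosses hp.2.2 h₃ h h₁.lt h₂.lt) not_false
      have := h₂.lt
      omega

theorem IsTriangulation.lower_induction {n : ℕ} {T : Set Arc} (hT : IsTriangulation T)
    (hB : HasBridging n T) {P : ℤ → Prop} (base : ∀ p, Arc.bridging p ∈ T → P p)
    (step : ∀ a p c, IsLowerTriangle T a p c → P a → P c → P p) (p : ℤ) : P p := by
  obtain ⟨μ, hμ⟩ := hT.exists_rank hB
  induction hk : μ p using Nat.strong_induction_on generalizing p with
  | _ k ih =>
    by_cases hp : Arc.bridging p ∈ T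
    · exact base p hp
    · obtain ⟨a, c, h⟩ := hT.exists_base hB hp
      subst hk
      exact step a p c h (ih _ (hμ a p c h).1 a rfl) (ih _ (hμ a p c h).2 c rfl)

/-- Values at the vertices of the bridging arcs extend additively to all lower vertices. -/
theorem IsTriangulation.exists_additive {M : Type*} [Add M] {n : ℕ} {T : Set Arc}
    (hT : IsTriangulation T) (hB : HasBridging n T) (f : ℤ → M) :
    ∃ v : ℤ → M, (∀ p, Arc.bridging p ∈ T → v p = f p) ∧
      ∀ a p c, IsLowerTriangle T a p c → v p = v a + v c := by
  classical
  obtain ⟨μ, hμ⟩ := hT.exists_rank hB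
  choose! l r h using fun p (hp : Arc.bridging p ∉ T) => hT.exists_base hB hp
  let F : (p : ℤ) → ((q : ℤ) → InvImage (· < ·) μ q p → M) → M := fun p ih =>
    if hp : Arc.bridging p ∈ T then f p
    else ih (l p) (hμ _ _ _ (h p hp)).1 + ih (r p) (hμ _ _ _ (h p hp)).2
  have wf : WellFounded (InvImage (· < ·) μ) := InvImage.wf μ wellFounded_lt
  refine ⟨wf.fix F, fun p hp => ?_, fun a p c hp => ?_⟩
  · rw [wf.fix_eq]
    simp [F, hp]
  · have hpB := hp.not_bridging hT
    obtain ⟨rfl, rfl⟩ := hT.base_unique (h p hpB) hp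
    conv_lhs => rw [wf.fix_eq]
    simp [F, hpB]

end Strip

/-! ### Counting the triangles at a lower vertex -/

namespace Strip

/-- The lower vertices joined with `p` by a peripheral arc of `T` with left end `p`. -/
def rightArcs (T : Set Arc) (p : ℤ) : Set ℤ := {c | p + 2 ≤ c ∧ Joined T p c}

/-- The lower vertices joined with `p` by a peripheral arc of `T` with right end `p`. -/
def leftArcs (T : Set Arc) (p : ℤ) : Set ℤ := {a | a + 2 ≤ p ∧ Joined T a p}

/-- A function on the lower vertices that adds up along the triangles of `T`. -/
def IsAdditive {M : Type*} [Add M] (T : Set Arc) (v : ℤ → M) : Prop :=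
  ∀ a p c, IsLowerTriangle T a p c → v p = v a + v c

/-- Walk down the fan at `p` from `q` to `p + 1`: in a triangle `p < b < q` the value at `b` is the
value at `q` plus `v p`, so each peripheral arc passed contributes one `v p`. -/
theorem IsAdditive.apply_succ {T : Set Arc} (hT : IsTriangulation T) {v : ℤ → ℤ}
    (hv : IsAdditive T v) {p q : ℤ} (h : Joined T p q) :
    v (p + 1) = (rightArcs T p ∩ Set.Iic q).ncard * v p + v q := by
  induction hk : (q - p).toNat using Nat.strong_induction_on generalizing q with
  | _ k ih =>
    by_cases hq : q = p + 1
    · have : rightArcs T p ∩ Set.Iic q = ∅ := by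
        ext c
        simp only [rightArcs, Set.mem_inter_iff, Set.mem_ofPred_eq, Set.mem_Iic,
          Set.mem_empty_iff_false, iff_false]
        omega
      rw [this, hq]
      simp
    · have hpq := h.lt
      obtain ⟨b, hb⟩ := hT.exists_apex h (by omega)
      have h₁ := hb.1.lt
      have h₂ := hb.2.1.lt
      -- An arc from `p` ending strictly between `b` and `q` would cross `b q`.
      have hins : rightArcs T p ∩ Set.Iic q = insert q (rightArcs T p ∩ Set.Iic b) := by
        ext c
        simp only [rightArcs, Set.mem_inter_iff, Set.mem_ofPred_eq, Set.mem_Iic, Set.mem_insert_iff]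
        constructor
        · rintro ⟨⟨hc, hj⟩, hcq⟩
          by_contra hne
          push Not at hne
          have := hne.2 ⟨hc, hj⟩
          exact hT.joined_not_crosses hj hb.2.1 h₁ this (by omega)
        · rintro (rfl | ⟨⟨hc, hj⟩, hcb⟩)
          · exact ⟨⟨by omega, h⟩, le_rfl⟩
          · exact ⟨⟨hc, hj⟩, by omega⟩
      have hfin : (rightArcs T p ∩ Set.Iic b).Finite :=
        (Set.finite_Icc p b).subset fun c hc => ⟨by have := hc.1.1; omega, hc.2⟩
      rw [ih _ (by omega) hb.1 rfl, hv p b q hb, hins,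
        Set.ncard_insert_of_notMem (fun hm => absurd hm.2 (by simpa using h₂)) hfin]
      push_cast
      ring

theorem IsAdditive.apply_pred {T : Set Arc} (hT : IsTriangulation T) {v : ℤ → ℤ}
    (hv : IsAdditive T v) {p q : ℤ} (h : Joined T q p) :
    v (p - 1) = (leftArcs T p ∩ Set.Ici q).ncard * v p + v q := by
  induction hk : (p - q).toNat using Nat.strong_induction_on generalizing q with
  | _ k ih =>
    by_cases hq : q = p - 1
    · have : leftArcs T p ∩ Set.Ici q = ∅ := by
        ext c
        simp only [leftArcs, Set.mem_inter_iff, Set.mem_ofPred_eq, Set.mem_Ici,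
          Set.mem_empty_iff_false, iff_false]
        omega
      rw [this, hq]
      simp
    · have hpq := h.lt
      obtain ⟨b, hb⟩ := hT.exists_apex h (by omega)
      have h₁ := hb.1.lt
      have h₂ := hb.2.1.lt
      have hins : leftArcs T p ∩ Set.Ici q = insert q (leftArcs T p ∩ Set.Ici b) := by
        ext c
        simp only [leftArcs, Set.mem_inter_iff, Set.mem_ofPred_eq, Set.mem_Ici, Set.mem_insert_iff]
        constructor
        · rintro ⟨⟨hc, hj⟩, hcq⟩
          by_contra hne
          push Not at hne
          have := hne.2 ⟨hc, hj⟩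
          exact hT.joined_not_crosses hb.1 hj (by omega) this h₂
        · rintro (rfl | ⟨⟨hc, hj⟩, hcb⟩)
          · exact ⟨⟨by omega, h⟩, le_rfl⟩
          · exact ⟨⟨hc, hj⟩, by omega⟩
      have hfin : (leftArcs T p ∩ Set.Ici b).Finite :=
        (Set.finite_Icc b p).subset fun c hc => ⟨hc.2, by have := hc.1.1; omega⟩
      rw [ih _ (by omega) hb.2.1 rfl, hv q b p hb, hins,
        Set.ncard_insert_of_notMem (fun hm => absurd hm.2 (by simpa using h₁)) hfin]
      push_cast
      ring

theorem IsTriangulation.rightArcs_finite {n : ℕ} {T : Set Arc} (hT : IsTriangulation T)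
    (hB : HasBridging n T) (p : ℤ) : (rightArcs T p).Finite :=
  (Set.finite_Icc p (p + n)).subset fun c hc =>
    ⟨hc.2.lt.le, by have := hT.joined_sub_le hB hc.2; omega⟩

theorem IsTriangulation.leftArcs_finite {n : ℕ} {T : Set Arc} (hT : IsTriangulation T)
    (hB : HasBridging n T) (p : ℤ) : (leftArcs T p).Finite :=
  (Set.finite_Icc (p - n) p).subset fun c hc =>
    ⟨by have := hT.joined_sub_le hB hc.2; omega, hc.2.lt.le⟩

/-- The triangles having `p` as leftmost or rightmost lower corner of three correspond to the
peripheral arcs at `p`; the set `E` holds the remaining triangles at `p`. -/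
theorem IsTriangulation.quiddity_eq {n : ℕ} {T : Set Arc} (hT : IsTriangulation T)
    (hB : HasBridging n T) (p : ℤ) (E : Finset Triangle)
    (hE : ∀ τ, τ ∈ E ↔ (∃ a c, τ = .lower a p c ∧ IsLowerTriangle T a p c) ∨
      (∃ b, τ = .upper p b ∧ IsUpperTriangle T p b) ∨
      (∃ b, τ = .upper b p ∧ IsUpperTriangle T b p)) :
    quiddity T p = (rightArcs T p).ncard + (leftArcs T p).ncard + E.card := by
  choose! f hf using fun c (hc : c ∈ rightArcs T p) => hT.exists_apex hc.2 hc.1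
  choose! g hg using fun a (ha : a ∈ leftArcs T p) => hT.exists_apex ha.2 ha.1
  have key : {τ : Triangle | τ.MemOf T ∧ τ.Incident p} =
      ((fun c => Triangle.lower p (f c) c) '' rightArcs T p ∪
        (fun a => Triangle.lower a (g a) p) '' leftArcs T p) ∪ E := by
    ext τ
    simp only [Set.mem_ofPred_eq, Set.mem_union, Set.mem_image, Finset.mem_coe, hE]
    constructor
    · rintro ⟨hτ, hp⟩
      rcases τ with ⟨a, b, c⟩ | ⟨a, b⟩
      · rw [memOf_lower_iff] at hτ
        have h₁ := hτ.1.lt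
        have h₂ := hτ.2.1.lt
        rcases hp with rfl | rfl | rfl
        · have hc : c ∈ rightArcs T p := ⟨by omega, hτ.2.2⟩
          exact Or.inl (Or.inl ⟨c, hc, by rw [hT.apex_unique (hf c hc) hτ]⟩)
        · exact Or.inr (Or.inl ⟨a, c, rfl, hτ⟩)
        · have ha : a ∈ leftArcs T p := ⟨by omega, hτ.2.2⟩
          exact Or.inl (Or.inr ⟨a, ha, by rw [hT.apex_unique (hg a ha) hτ]⟩)
      · rcases hp with rfl | rfl
        · exact Or.inr (Or.inr (Or.inl ⟨b, rfl, hτ⟩))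
        · exact Or.inr (Or.inr (Or.inr ⟨a, rfl, hτ⟩))
    · rintro ((⟨c, hc, rfl⟩ | ⟨a, ha, rfl⟩) | ⟨a, c, rfl, h⟩ | ⟨b, rfl, h⟩ | ⟨b, rfl, h⟩)
      · exact ⟨memOf_lower_iff.2 (hf c hc), Or.inl rfl⟩
      · exact ⟨memOf_lower_iff.2 (hg a ha), Or.inr (Or.inr rfl)⟩
      · exact ⟨memOf_lower_iff.2 h, Or.inr (Or.inl rfl)⟩
      · exact ⟨h, Or.inl rfl⟩
      · exact ⟨h, Or.inr rfl⟩
  have hR := hT.rightArcs_finite hB p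
  have hL := hT.leftArcs_finite hB p
  rw [quiddity, key, Set.ncard_union_eq ?_ ((hR.image _).union (hL.image _)) E.finite_toSet,
    Set.ncard_union_eq ?_ (hR.image _) (hL.image _), Set.ncard_image_of_injective,
    Set.ncard_image_of_injective, Set.ncard_coe_finset]
  · intro a b h
    simpa using congrArg (fun τ => match τ with | .lower a _ _ => a | .upper a _ => a) h
  · intro a b h
    simpa using congrArg (fun τ => match τ with | .lower _ _ a => a | .upper a _ => a) h
  · rw [Set.disjoint_left]
    rintro _ ⟨c, hc, rfl⟩ ⟨a, ha, h⟩
    have h' : a = p := by simp at h; exact h.1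
    have := ha.1
    omega
  · rw [Set.disjoint_left]
    rintro _ (⟨c, hc, rfl⟩ | ⟨a, ha, rfl⟩) h
    · have := (hf c hc).1.lt
      simp [hE] at h
      omega
    · have := (hg a ha).2.1.lt
      simp [hE] at h
      omega

/-- The two fans at `p` account for the peripheral arcs. What remains is `v a + v c` for the
outermost neighbours, or for the adjacent bridging feet when `p` has a bridging arc. It equals `v p`
or `2 * v p`, matching the one or two triangles at `p` that no peripheral arc counts. -/
theorem IsTriangulation.quiddity_mul {n : ℕ} {T : Set Arc} (hT : IsTriangulation T)
    (hB : HasBridging n T) {v : ℤ → ℤ} (hv : IsAdditive T v)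
    (hv' : ∀ a p c, IsUpperTriangle T a p → IsUpperTriangle T p c → v a + v c = 2 * v p) (p : ℤ) :
    v (p - 1) + v (p + 1) = quiddity T p * v p := by
  classical
  have hle : ∀ c, Joined T p c → (∀ d, Joined T p d → d ≤ c) →
      rightArcs T p ∩ Set.Iic c = rightArcs T p :=
    fun c _ h => Set.inter_eq_left.2 fun d hd => h d hd.2
  have hge : ∀ a, Joined T a p → (∀ d, Joined T d p → a ≤ d) →
      leftArcs T p ∩ Set.Ici a = leftArcs T p :=
    fun a _ h => Set.inter_eq_left.2 fun d hd => h d hd.2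
  by_cases hp : Arc.bridging p ∈ T
  · obtain ⟨a, ha⟩ := hT.exists_prev hB hp
    obtain ⟨c, hc⟩ := hT.exists_next hB hp
    have hq := hT.quiddity_eq hB p {.upper a p, .upper p c} (by
      intro τ
      simp only [Finset.mem_insert, Finset.mem_singleton]
      constructor
      · rintro (rfl | rfl)
        exacts [Or.inr (Or.inr ⟨a, rfl, ha⟩), Or.inr (Or.inl ⟨c, rfl, hc⟩)]
      · rintro (⟨d, e, -, h⟩ | ⟨b, rfl, h⟩ | ⟨b, rfl, h⟩)
        · exact absurd hp (h.not_bridging hT)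
        · rw [hT.next_unique h hc]; exact Or.inr rfl
        · rw [hT.prev_unique h ha]; exact Or.inl rfl)
    rw [Finset.card_pair (by have := ha.1.lt; simp; omega)] at hq
    rw [hv.apply_pred hT ha.1, hv.apply_succ hT hc.1, hq,
      hle c hc.1 fun d hd => not_lt.1 fun h => hT.joined_not_crosses_bridging hd hc.2.2 hc.1.lt h,
      hge a ha.1 fun d hd => not_lt.1 fun h => hT.joined_not_crosses_bridging hd ha.2.1 h ha.1.lt]
    push_cast
    linear_combination hv' a p c ha hc
  · obtain ⟨a, c, h⟩ := hT.exists_base hB hp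
    have hq := hT.quiddity_eq hB p {.lower a p c} (by
      intro τ
      simp only [Finset.mem_singleton]
      constructor
      · rintro rfl
        exact Or.inl ⟨a, c, rfl, h⟩
      · rintro (⟨d, e, rfl, h'⟩ | ⟨b, -, h'⟩ | ⟨b, -, h'⟩)
        · obtain ⟨rfl, rfl⟩ := hT.base_unique h h'; rfl
        · exact absurd h'.2.1 hp
        · exact absurd h'.2.2 hp)
    rw [Finset.card_singleton] at hq
    rw [hv.apply_pred hT h.1, hv.apply_succ hT h.2.1, hq,
      hle c h.2.1 fun d hd => not_lt.1 fun hlt => hT.joined_not_crosses h.2.2 hd h.1.lt h.2.1.lt hlt,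
      hge a h.1 fun d hd => not_lt.1 fun hlt => hT.joined_not_crosses hd h.2.2 hlt h.1.lt h.2.1.lt]
    push_cast
    linear_combination - hv a p c h

end Strip

/-! ### The labeling algorithm -/

namespace Strip

theorem perm_three {α : Type*} {x y z a b c : α} (h : [x, y, z].Perm [a, b, c]) :
    (z = a ∧ (x = b ∧ y = c ∨ x = c ∧ y = b)) ∨ (z = b ∧ (x = a ∧ y = c ∨ x = c ∧ y = a)) ∨
      (z = c ∧ (x = a ∧ y = b ∨ x = b ∧ y = a)) := by
  have := List.mem_permutations'.2 h
  simp at this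
  tauto

/-- The properties of a partial labeling `P` that are preserved by the labeling algorithm. -/
structure IsPartialLabeling (T : Set Arc) (L : ℤ → ℕ) (P : Vertex → ℕ → Prop) : Prop where
  upper : ∀ k x, P (.upper k) x ↔ x = 0
  lower : ∀ p x, P (.lower p) x → x = L p
  closed : ∀ a p c, IsLowerTriangle T a p c → ∀ x, P (.lower p) x →
    (∃ y, P (.lower a) y) ∧ ∃ y, P (.lower c) y

theorem InitialLabel.eq_or {n : ℕ} {T : Set Arc} {c : ℤ} {w : Vertex} {x : ℕ}
    (h : InitialLabel n T (.upper c) w x) :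
    (∀ k, w = .upper k → x = 0) ∧ ∀ p, w = .lower p → x = 1 ∧ Arc.bridging p ∈ T := by
  induction h with
  | start => simp
  | @neighbor w h =>
    cases w with
    | lower p => exact ⟨by simp, by rintro q ⟨⟩; exact ⟨rfl, h.1⟩⟩
    | upper k => exact h.elim
  | upper h ih => exact ⟨fun _ _ => ih.1 _ rfl, by simp⟩

theorem isPartialLabeling_initialLabel {n : ℕ} {T : Set Arc} (hT : IsTriangulation T)
    {L : ℤ → ℕ} (hL : ∀ p, Arc.bridging p ∈ T → L p = 1) (c : ℤ) :
    IsPartialLabeling T L (InitialLabel n T (.upper c)) where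
  upper k x := ⟨fun h => h.eq_or.1 k rfl, by rintro rfl; exact .upper .start⟩
  lower p x h := by
    obtain ⟨rfl, hp⟩ := h.eq_or.2 p rfl
    exact (hL p hp).symm
  closed a p c hp x h := absurd (h.eq_or.2 p rfl).2 (hp.not_bridging hT)

/-- A lower triangle can only pass a label to its middle corner: by `closed`, a labelled middle
corner has labelled neighbours in the triangle, so no outer corner gets a sum where a difference
would be due. In an upper triangle the top already has label 0, so the new label is `1 + 0`. -/
theorem NextLabel.eq_or {n : ℕ} {T : Set Arc} {L : ℤ → ℕ}
    (hL : ∀ p, Arc.bridging p ∈ T → L p = 1) {P : Vertex → ℕ → Prop}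
    (hP : IsPartialLabeling T L P) {w : Vertex} {x : ℕ} (h : NextLabel n T P w x) :
    P w x ∨ (∃ a p c y z, w = .lower p ∧ IsLowerTriangle T a p c ∧ P (.lower a) y ∧
      P (.lower c) z ∧ x = y + z) ∨ ∃ p, w = .lower p ∧ Arc.bridging p ∈ T ∧ x = 1 := by
  induction h with
  | keep h => exact Or.inl h
  | @add τ w₁ w₂ w₃ x y hτ hw hx hy hn =>
    right
    cases τ with
    | lower a b c =>
      rw [memOf_lower_iff] at hτ
      left
      rcases perm_three hw with ⟨rfl, ⟨rfl, rfl⟩ | ⟨rfl, rfl⟩⟩ | ⟨rfl, ⟨rfl, rfl⟩ | ⟨rfl, rfl⟩⟩ |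
        ⟨rfl, ⟨rfl, rfl⟩ | ⟨rfl, rfl⟩⟩
      · exact absurd (hP.closed _ _ _ hτ _ hx).1 (not_exists.2 hn)
      · exact absurd (hP.closed _ _ _ hτ _ hy).1 (not_exists.2 hn)
      · exact ⟨a, b, c, x, y, rfl, hτ, hx, hy, rfl⟩
      · exact ⟨a, b, c, y, x, rfl, hτ, hy, hx, add_comm x y⟩
      · exact absurd (hP.closed _ _ _ hτ _ hy).2 (not_exists.2 hn)
      · exact absurd (hP.closed _ _ _ hτ _ hx).2 (not_exists.2 hn)
    | upper a b =>
      right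
      obtain ⟨-, ha, hb⟩ := hτ
      obtain ⟨k, -, -, hw⟩ := hw
      have h0 := (hP.upper k 0).2 rfl
      rcases perm_three hw with ⟨rfl, ⟨rfl, rfl⟩ | ⟨rfl, rfl⟩⟩ | ⟨rfl, ⟨rfl, rfl⟩ | ⟨rfl, rfl⟩⟩ |
        ⟨rfl, -⟩
      · exact ⟨a, rfl, ha, by rw [hP.lower _ _ hx, (hP.upper _ _).1 hy, hL b hb]⟩
      · exact ⟨a, rfl, ha, by rw [hP.lower _ _ hy, (hP.upper _ _).1 hx, hL b hb]⟩
      · exact ⟨b, rfl, hb, by rw [hP.lower _ _ hx, (hP.upper _ _).1 hy, hL a ha]⟩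
      · exact ⟨b, rfl, hb, by rw [hP.lower _ _ hy, (hP.upper _ _).1 hx, hL a ha]⟩
      · exact absurd h0 (hn 0)
  | @upper k k' x h ih =>
    left
    rcases ih with h | ⟨a, p, c, y, z, h, -⟩ | ⟨p, h, -⟩
    · exact (hP.upper k' x).2 ((hP.upper k x).1 h)
    · exact absurd h (by simp)
    · exact absurd h (by simp)

theorem IsPartialLabeling.nextLabel {n : ℕ} {T : Set Arc} (hT : IsTriangulation T)
    {L : ℤ → ℕ} (hL : ∀ p, Arc.bridging p ∈ T → L p = 1)
    (hL' : ∀ a p c, IsLowerTriangle T a p c → L p = L a + L c) {P : Vertex → ℕ → Prop}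
    (hP : IsPartialLabeling T L P) : IsPartialLabeling T L (NextLabel n T P) where
  upper k x := by
    refine ⟨fun h => ?_, fun h => .keep ((hP.upper k x).2 h)⟩
    rcases h.eq_or hL hP with h | ⟨a, p, c, y, z, h, -⟩ | ⟨p, h, -⟩
    · exact (hP.upper k x).1 h
    · exact absurd h (by simp)
    · exact absurd h (by simp)
  lower p x h := by
    rcases h.eq_or hL hP with h | ⟨a, p, c, y, z, ⟨⟩, h₁, hy, hz, rfl⟩ | ⟨p, ⟨⟩, hp, rfl⟩
    · exact hP.lower p x h
    · rw [hP.lower _ _ hy, hP.lower _ _ hz, hL' _ _ _ h₁]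
    · exact (hL p hp).symm
  closed a p c hp x h := by
    rcases h.eq_or hL hP with h | ⟨a, p, c, y, z, ⟨⟩, h₁, hy, hz, rfl⟩ | ⟨p, ⟨⟩, hpB, rfl⟩
    · obtain ⟨⟨y, hy⟩, ⟨z, hz⟩⟩ := hP.closed a p c hp x h
      exact ⟨⟨y, .keep hy⟩, ⟨z, .keep hz⟩⟩
    · obtain ⟨rfl, rfl⟩ := hT.base_unique h₁ hp
      exact ⟨⟨y, .keep hy⟩, ⟨z, .keep hz⟩⟩
    · exact absurd hpB (hp.not_bridging hT)

theorem isPartialLabeling_labelAfter {n : ℕ} {T : Set Arc} (hT : IsTriangulation T)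
    {L : ℤ → ℕ} (hL : ∀ p, Arc.bridging p ∈ T → L p = 1)
    (hL' : ∀ a p c, IsLowerTriangle T a p c → L p = L a + L c) (c : ℤ) (s : ℕ) :
    IsPartialLabeling T L (LabelAfter n T (.upper c) s) := by
  induction s with
  | zero => exact isPartialLabeling_initialLabel hT hL c
  | succ s ih => exact ih.nextLabel hT hL hL'

theorem labelAfter_mono {n : ℕ} {T : Set Arc} {v w : Vertex} {x : ℕ} {s t : ℕ} (hst : s ≤ t)
    (h : LabelAfter n T v s w x) : LabelAfter n T v t w x := by
  induction hst with
  | refl => exact h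
  | step _ ih => exact .keep ih

/-- The labeling algorithm attaches a label to `w`. -/
def IsLabeled (n : ℕ) (T : Set Arc) (v w : Vertex) : Prop := ∃ x, IsLabel n T v w x

/-- Labels are kept from round to round; if the third corner never had one, the rule would apply as
soon as both others do. -/
theorem IsLabeled.third {n : ℕ} {T : Set Arc} {v w₁ w₂ w₃ : Vertex} {τ : Triangle}
    (hτ : τ.MemOf T) (hw : τ.Corners n w₁ w₂ w₃) (h₁ : IsLabeled n T v w₁)
    (h₂ : IsLabeled n T v w₂) : IsLabeled n T v w₃ := by
  by_contra h₃
  obtain ⟨x, s, hx⟩ := h₁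
  obtain ⟨y, t, hy⟩ := h₂
  refine h₃ ⟨x + y, max s t + 1, .add hτ hw (labelAfter_mono (le_max_left s t) hx)
    (labelAfter_mono (le_max_right s t) hy) fun z hz => h₃ ⟨z, _, hz⟩⟩

theorem level_mono {n : ℕ} (hn : 1 ≤ n) {p q : ℤ} (h : p ≤ q) : level n p ≤ level n q :=
  Int.ediv_le_ediv (by omega) (by omega)

theorem isLabeled_upper (n : ℕ) (T : Set Arc) (c k : ℤ) :
    IsLabeled n T (.upper c) (.upper k) := ⟨0, 0, InitialLabel.upper .start⟩

theorem isLabeled_upperTriangle {n : ℕ} (hn : 1 ≤ n) {T : Set Arc} {c a b : ℤ} (h : IsUpperTriangle T a b) :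
    IsLabeled n T (.upper c) (.lower a) ↔ IsLabeled n T (.upper c) (.lower b) := by
  have hk := level_mono hn h.1.lt.le
  constructor
  · intro ha
    refine .third (τ := .upper a b) h ⟨level n a, le_rfl, hk, ?_⟩ ha
      (isLabeled_upper n T c (level n a))
    exact (List.Perm.swap _ _ _).cons _
  · intro hb
    refine .third (τ := .upper a b) h ⟨level n a, le_rfl, hk, ?_⟩ hb
      (isLabeled_upper n T c (level n a))
    exact ((List.Perm.swap _ _ _).cons _).trans ((List.Perm.swap _ _ _).trans
      ((List.Perm.refl _)))

theorem isLabeled_bridging {n : ℕ} (hn : 1 ≤ n) {T : Set Arc} (hT : IsTriangulation T)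
    (hB : HasBridging n T) {c β : ℤ} (hβ : Arc.bridging β ∈ T)
    (h : IsLabeled n T (.upper c) (.lower β)) {p : ℤ} (hp : Arc.bridging p ∈ T) :
    IsLabeled n T (.upper c) (.lower p) := by
  induction hk : (p - β).natAbs using Nat.strong_induction_on generalizing p with
  | _ k ih =>
    rcases lt_trichotomy p β with hlt | rfl | hlt
    · obtain ⟨q, hq⟩ := hT.exists_next hB hp
      have := hq.1.lt
      have := mt (hT.joined_not_crosses_bridging hq.1 hβ hlt) not_false
      exact (isLabeled_upperTriangle hn hq).2 (ih _ (by omega) hq.2.2 rfl)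
    · exact h
    · obtain ⟨q, hq⟩ := hT.exists_prev hB hp
      have := hq.1.lt
      have := mt (fun h => hT.joined_not_crosses_bridging hq.1 hβ h hlt) not_false
      exact (isLabeled_upperTriangle hn hq).1 (ih _ (by omega) hq.2.1 rfl)

theorem isLabel_iff {n : ℕ} {T : Set Arc} (hn : 1 ≤ n) (hT : IsTriangulation T)
    (hB : HasBridging n T)
    {L : ℤ → ℕ} (hL : ∀ p, Arc.bridging p ∈ T → L p = 1)
    (hL' : ∀ a p c, IsLowerTriangle T a p c → L p = L a + L c) (c p : ℤ) (x : ℕ) :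
    IsLabel n T (.upper c) (.lower p) x ↔ x = L p := by
  have hlab : IsLabeled n T (.upper c) (.lower p) := by
    refine hT.lower_induction hB (P := fun p => IsLabeled n T (.upper c) (.lower p)) ?_ ?_ p
    -- The vertices in `(c * n, c * n + n]` are exactly those of level `c`, so `β` is joined with
    -- the starting vertex. Its label spreads to the other bridging feet through the upper
    -- triangles.
    · obtain ⟨β, hβ, h₁, h₂⟩ := hB (c * n)
      have hlev : level n β = c := by
        have hn' : (0 : ℤ) < n := by omega
        refine le_antisymm (Int.lt_add_one_iff.1 ?_) ?_
        · exact (Int.ediv_lt_iff_lt_mul hn').2 (by linarith)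
        · exact (Int.le_ediv_iff_mul_le hn').2 (by linarith)
      exact fun q hq => isLabeled_bridging hn hT hB hβ ⟨1, 0, .neighbor ⟨hβ, hlev.symm⟩⟩ hq
    · intro a b d h ha hd
      exact .third (τ := .lower a b d) (memOf_lower_iff.2 h) ((List.Perm.swap _ _ _).cons _) ha hd
  have heq : ∀ y, IsLabel n T (.upper c) (.lower p) y → y = L p :=
    fun y ⟨s, hs⟩ => (isPartialLabeling_labelAfter hT hL hL' c s).lower p y hs
  refine ⟨heq x, ?_⟩
  rintro rfl
  obtain ⟨y, hy⟩ := hlab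
  rwa [← heq y hy]

end Strip

/-! ### Uniqueness of the frieze with a given quiddity row -/

namespace Frieze

/-- The unimodular rule can be solved for its outermost entry, since that entry is multiplied by the
positive entry `m (i + 1) (j - 1)`. -/
theorem IsInfiniteFrieze.eq_of_diag {m m' : ℤ → ℤ → ℤ} (h : IsInfiniteFrieze m)
    (h' : IsInfiniteFrieze m') (hd : ∀ i, m i i = m' i i) {i j : ℤ} (hij : i - 2 ≤ j) :
    m i j = m' i j := by
  induction hk : (j - (i - 2)).toNat using Nat.strong_induction_on generalizing i j with
  | _ k ih =>
    by_cases h₁ : j ≤ i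
    · obtain rfl | rfl | rfl : j = i - 2 ∨ j = i - 1 ∨ j = i := by omega
      · rw [h.zero, h'.zero]
      · rw [h.one, h'.one]
      · exact hd _
    · have e₁ := ih _ (by omega) (i := i) (j := j - 1) (by omega) rfl
      have e₂ := ih _ (by omega) (i := i + 1) (j := j) (by omega) rfl
      have e₃ := ih _ (by omega) (i := i + 1) (j := j - 1) (by omega) rfl
      have u := h.unimodular i (j - 1) (by omega)
      have u' := h'.unimodular i (j - 1) (by omega)
      rw [sub_add_cancel, e₁, e₂, e₃] at u
      rw [sub_add_cancel] at u'
      have hpos : 0 < m' (i + 1) (j - 1) := by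
        by_cases hj : i + 1 ≤ j - 1
        · exact h'.pos _ _ hj
        · rw [show j - 1 = i + 1 - 1 by omega, h'.one]
          exact one_pos
      exact mul_left_cancel₀ hpos.ne' (by linarith)

end Frieze

/-! ### Translation by `n` and the numbering of the bridging arcs -/

namespace Strip

theorem Joined.translate {n : ℕ} {T : Set Arc}
    (hper : ∀ α ∈ T, ∀ t : ℤ, α.translate (t * n) ∈ T) {a b : ℤ} (h : Joined T a b) :
    Joined T (a + n) (b + n) := by
  rcases h with rfl | ⟨h, hm⟩
  · exact Or.inl (by ring)
  · have := hper _ hm 1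
    simp only [one_mul, Arc.translate] at this
    exact Or.inr ⟨by omega, this⟩

theorem IsLowerTriangle.translate {n : ℕ} {T : Set Arc}
    (hper : ∀ α ∈ T, ∀ t : ℤ, α.translate (t * n) ∈ T) {a b c : ℤ} (h : IsLowerTriangle T a b c) :
    IsLowerTriangle T (a + n) (b + n) (c + n) :=
  ⟨h.1.translate hper, h.2.1.translate hper, h.2.2.translate hper⟩

theorem bridging_translate {n : ℕ} {T : Set Arc}
    (hper : ∀ α ∈ T, ∀ t : ℤ, α.translate (t * n) ∈ T) {p : ℤ} (h : Arc.bridging p ∈ T) (t : ℤ) :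
    Arc.bridging (p + t * n) ∈ T := hper _ h t

theorem IsFundamentalDomain.translate_mem {n : ℕ} {T : Set Arc} {i : ℤ}
    (h : IsFundamentalDomain n T i) : ∀ α ∈ T, ∀ t : ℤ, α.translate (t * n) ∈ T := by
  intro α hα t
  rw [h.2.2] at hα ⊢
  obtain ⟨β, hβ, hβ', s, rfl⟩ := hα
  refine ⟨β, hβ, hβ', s + t, ?_⟩
  cases β <;> simp only [Arc.translate, Arc.peripheral.injEq, Arc.bridging.injEq] <;>
    (try constructor) <;> ring

theorem hasBridging_of_translate {n : ℕ} (hn : 1 ≤ n) {T : Set Arc}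
    (hper : ∀ α ∈ T, ∀ t : ℤ, α.translate (t * n) ∈ T) {i : ℤ} (hi : Arc.bridging i ∈ T) :
    HasBridging n T := by
  intro a
  -- The translate of `i` in the window: it equals `a + 1 + (i - a - 1) % n`.
  refine ⟨i + -((i - a - 1) / n) * n, bridging_translate hper hi _, ?_, ?_⟩
  all_goals
    have h₁ := Int.emod_nonneg (i - a - 1) (b := n) (by omega)
    have h₂ := Int.emod_lt_of_pos (i - a - 1) (b := n) (by omega)
    have h₃ := Int.emod_add_mul_ediv (i - a - 1) n
    linarith

theorem exists_int_primitive (g : ℤ → ℤ) : ∃ f : ℤ → ℤ, ∀ p, f (p + 1) = f p + g p := by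
  refine ⟨fun p => ∑ k ∈ Finset.range p.toNat, g k -
    ∑ k ∈ Finset.range (-p).toNat, g (-k - 1), fun p => ?_⟩
  rcases le_or_gt 0 p with hp | hp
  · lift p to ℕ using hp
    beta_reduce
    rw [show ((p : ℤ) + 1).toNat = p + 1 by omega, show (-((p : ℤ) + 1)).toNat = 0 by omega,
      show (-(p : ℤ)).toNat = 0 by omega, Int.toNat_natCast, Finset.sum_range_succ]
    simp
  · obtain ⟨k, rfl⟩ : ∃ k : ℕ, p = -k - 1 := ⟨(-p - 1).toNat, by omega⟩
    beta_reduce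
    rw [show (-(k : ℤ) - 1 + 1).toNat = 0 by omega, show (-(k : ℤ) - 1).toNat = 0 by omega,
      show (-(-(k : ℤ) - 1 + 1)).toNat = k by omega, show (-(-(k : ℤ) - 1)).toNat = k + 1 by omega,
      Finset.sum_range_succ]
    simp

open Classical in
theorem bridgingCount_eq_card {n : ℕ} (hn : 1 ≤ n) {T : Set Arc}
    (hper : ∀ α ∈ T, ∀ t : ℤ, α.translate (t * n) ∈ T) (p : ℤ) :
    bridgingCount n T = ((Finset.range n).filter fun j : ℕ => Arc.bridging (p + j) ∈ T).card := by
  have hinj : Set.InjOn (fun j : ℕ => ((p + j : ℤ) : ZMod n))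
      ((Finset.range n).filter fun j : ℕ => Arc.bridging (p + j) ∈ T) := by
    intro i hi j hj hij
    simp only [Finset.coe_filter, Finset.mem_range, Set.mem_ofPred_eq] at hi hj
    have := (ZMod.intCast_eq_intCast_iff _ _ _).1 hij
    have := Int.ModEq.add_left_cancel' p this
    exact Nat.ModEq.eq_of_lt_of_lt (Int.natCast_modEq_iff.1 this) hi.1 hj.1
  rw [← Set.ncard_coe_finset, ← hinj.ncard_image, bridgingCount]
  congr 1
  ext z
  simp only [Set.mem_image, Finset.coe_filter, Finset.mem_range, Set.mem_ofPred_eq]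
  constructor
  · rintro ⟨q, hq, rfl⟩
    have h₁ := Int.emod_nonneg (q - p) (b := n) (by omega)
    have h₂ := Int.emod_lt_of_pos (q - p) (b := n) (by omega)
    have h₃ := Int.emod_add_mul_ediv (q - p) n
    have h₄ : p + ((q - p) % n).toNat = q + -((q - p) / n) * n := by
      rw [Int.toNat_of_nonneg h₁]; linarith
    refine ⟨((q - p) % n).toNat, ⟨by omega, ?_⟩, ?_⟩
    · rw [h₄]
      exact bridging_translate hper hq _
    · rw [h₄]
      simp
  · rintro ⟨j, ⟨-, hj⟩, rfl⟩
    exact ⟨p + j, hj, rfl⟩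

/-- A numbering of the bridging arcs from left to right. -/
theorem exists_bridging_index {n : ℕ} (hn : 1 ≤ n) {T : Set Arc} (hT : IsTriangulation T)
    (hper : ∀ α ∈ T, ∀ t : ℤ, α.translate (t * n) ∈ T) :
    ∃ f : ℤ → ℤ, (∀ p q, IsUpperTriangle T p q → f q = f p + 1) ∧
      ∀ p, f (p + n) = f p + bridgingCount n T := by
  classical
  -- Up to a constant, `f p` counts the bridging feet to the left of `p`.
  obtain ⟨f, hf⟩ := exists_int_primitive fun p => if Arc.bridging p ∈ T then 1 else 0
  refine ⟨f, fun p q h => ?_, fun p => ?_⟩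
  · have key : ∀ k : ℕ, p + 1 + k ≤ q → f (p + 1 + k) = f p + 1 := by
      intro k
      induction k with
      | zero => intro _; simp [hf, h.2.1]
      | succ k ih =>
        intro hk
        push_cast at hk ⊢
        rw [← add_assoc, hf, ih (by omega), if_neg, add_zero]
        exact fun hb => hT.joined_not_crosses_bridging h.1 hb (by omega) (by omega)
    have := h.1.lt
    obtain ⟨k, rfl⟩ : ∃ k : ℕ, q = p + 1 + k := ⟨(q - p - 1).toNat, by omega⟩
    exact key k le_rfl
  · have key : ∀ k : ℕ, f (p + k) = f p +
        ((Finset.range k).filter fun j : ℕ => Arc.bridging (p + j) ∈ T).card := by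
      intro k
      induction k with
      | zero => simp
      | succ k ih =>
        push_cast
        rw [← add_assoc, hf, ih, Finset.range_add_one, Finset.filter_insert]
        split_ifs <;> simp [add_assoc]
    rw [key, ← bridgingCount_eq_card hn hper p]

/-! ### Realization by vectors and the frieze of determinants -/

/-- Integral vectors `(x, L)` at the lower vertices that realize the triangulation, the upper
vertices being in direction `(1, 0)`. -/
structure IsRealization (n : ℕ) (T : Set Arc) (L : ℤ → ℕ) (x : ℤ → ℤ) : Prop where
  bridging : ∀ p, Arc.bridging p ∈ T → L p = 1
  additive : ∀ a p c, IsLowerTriangle T a p c → L p = L a + L c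
  fst_upper : ∀ p q, IsUpperTriangle T p q → x q = x p + 1
  fst_additive : IsAdditive T x
  periodic : ∀ p, L (p + n) = L p
  fst_periodic : ∀ p, x (p + n) = x p + bridgingCount n T * L p

theorem exists_isRealization {n : ℕ} (hn : 1 ≤ n) {T : Set Arc} (hT : IsTriangulation T)
    (hB : HasBridging n T) (hper : ∀ α ∈ T, ∀ t : ℤ, α.translate (t * n) ∈ T) :
    ∃ L x, IsRealization n T L x := by
  obtain ⟨f, hf, hf'⟩ := exists_bridging_index hn hT hper
  obtain ⟨L, hL, hL'⟩ := hT.exists_additive hB (fun _ => 1 : ℤ → ℕ)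
  obtain ⟨x, hx, hx'⟩ := hT.exists_additive hB f
  have hb : ∀ p, Arc.bridging p ∈ T → Arc.bridging (p + n) ∈ T := fun p hp => by
    simpa using bridging_translate hper hp 1
  have hLn : ∀ p, L (p + n) = L p := hT.lower_induction hB
    (fun p hp => by rw [hL _ (hb p hp), hL p hp])
    (fun a p c h ha hc => by rw [hL' _ _ _ (h.translate hper), ha, hc, hL' _ _ _ h])
  refine ⟨L, x, hL, hL', fun p q h => by rw [hx _ h.2.1, hx _ h.2.2, hf p q h], hx', hLn, ?_⟩
  -- The shear relation is linear in `(x, L)`, so it passes from the bridging feet, where `L = 1`,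
  -- to sums.
  refine hT.lower_induction hB (fun p hp => by rw [hx _ (hb p hp), hx p hp, hL p hp, hf']; simp)
    (fun a p c h ha hc => ?_)
  rw [hx' _ _ _ (h.translate hper), ha, hc, hx' _ _ _ h, hL' _ _ _ h]
  push_cast
  ring

/-- The determinant of the vectors at the lower vertices `p` and `q`. -/
def vectorDet (L : ℤ → ℕ) (x : ℤ → ℤ) (p q : ℤ) : ℤ := x q * L p - x p * L q

namespace IsRealization

variable {n : ℕ} {T : Set Arc} {L : ℤ → ℕ} {x : ℤ → ℤ}

theorem isAdditive (h : IsRealization n T L x) : IsAdditive T fun p => (L p : ℤ) :=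
  fun a p c hp => by simp [h.additive a p c hp]

theorem pos (h : IsRealization n T L x) (hT : IsTriangulation T) (hB : HasBridging n T) (p : ℤ) :
    0 < L p :=
  hT.lower_induction hB (P := fun p => 0 < L p) (fun p hp => by simp [h.bridging p hp])
    (fun a p c hp ha _ => by rw [h.additive a p c hp]; omega) p

theorem quiddity_mul (h : IsRealization n T L x) (hT : IsTriangulation T) (hB : HasBridging n T)
    (p : ℤ) : (L (p - 1) + L (p + 1) : ℤ) = quiddity T p * L p ∧
      x (p - 1) + x (p + 1) = quiddity T p * x p := by
  constructor
  · refine hT.quiddity_mul hB h.isAdditive (fun a p c ha hc => ?_) p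
    simp [h.bridging _ ha.2.1, h.bridging _ ha.2.2, h.bridging _ hc.2.2]
  · refine hT.quiddity_mul hB h.fst_additive (fun a p c ha hc => ?_) p
    rw [h.fst_upper p c hc, h.fst_upper a p ha]
    ring

/-- The recurrence `v (p-1) + v (p+1) = a_p • v p` makes the determinant of neighbours constant. At
a bridging foot `β` with next foot `q`, `v (β+1)` is `v q` plus a multiple of `v β`, so the
determinant is `x q - x β = 1`. -/
theorem vectorDet_succ (h : IsRealization n T L x) (hT : IsTriangulation T)
    (hB : HasBridging n T) (p : ℤ) : vectorDet L x p (p + 1) = 1 := by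
  obtain ⟨β, hβ, -⟩ := hB 0
  obtain ⟨q, hq⟩ := hT.exists_next hB hβ
  have base : vectorDet L x β (β + 1) = 1 := by
    have h₁ := h.isAdditive.apply_succ hT hq.1
    have h₂ := h.fst_additive.apply_succ hT hq.1
    simp only [vectorDet]
    rw [h₁, h₂, h.bridging β hβ, h.bridging q hq.2.2, h.fst_upper β q hq]
    push_cast
    ring
  have step : ∀ p, vectorDet L x (p - 1) p = vectorDet L x p (p + 1) := by
    intro p
    obtain ⟨h₁, h₂⟩ := h.quiddity_mul hT hB p
    simp only [vectorDet]
    linear_combination x p * h₁ - L p * h₂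
  induction p using Int.inductionOn' (b := β) with
  | zero => exact base
  | succ k _ ih => rw [← step (k + 1), add_sub_cancel_right, ih]
  | pred k _ ih => rw [sub_add_cancel, step, ih]

/-- The slopes `x p / L p` increase strictly, by `1 / (L p * L (p + 1))` at each step; `h₁` is this
with denominators cleared. -/
theorem vectorDet_pos (h : IsRealization n T L x) (hT : IsTriangulation T) (hB : HasBridging n T)
    {p q : ℤ} (hpq : p < q) : 0 < vectorDet L x p q := by
  induction q, hpq using Int.leInduction with
  | base => rw [h.vectorDet_succ hT hB]; exact one_pos
  | succ q _ ih =>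
    have h₁ : vectorDet L x p (q + 1) * L q =
        vectorDet L x p q * L (q + 1) + L p := by
      have := h.vectorDet_succ hT hB q
      simp only [vectorDet] at this ⊢
      linear_combination (L p : ℤ) * this
    have hL : ∀ k, (0 : ℤ) < L k := fun k => by exact_mod_cast h.pos hT hB k
    refine pos_of_mul_pos_left (b := (L q : ℤ)) ?_ (hL q).le
    rw [h₁]
    have := hL p
    have := hL (q + 1)
    positivity

theorem isAssociated (h : IsRealization n T L x) (hT : IsTriangulation T)
    (hB : HasBridging n T) :
    Frieze.IsAssociated T fun i j => vectorDet L x (i - 1) (j + 1) := by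
  refine ⟨⟨fun i => ?_, fun i => ?_, fun i j hij => ?_, fun i j _ => ?_⟩, fun i => ?_⟩
  · rw [show i - 2 + 1 = i - 1 by ring, vectorDet]
    ring
  · exact h.vectorDet_succ hT hB (i - 1)
  · exact h.vectorDet_pos hT hB (by omega)
  -- The unimodular rule is the Plücker relation for `v (i-1), v i, v (j+1), v (j+2)`, with both
  -- neighbouring determinants equal to 1.
  · have h₁ := h.vectorDet_succ hT hB (i - 1)
    have h₂ := h.vectorDet_succ hT hB (j + 1)
    rw [sub_add_cancel] at h₁
    rw [add_sub_cancel_right]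
    simp only [vectorDet] at h₁ h₂ ⊢
    linear_combination h₁ + (x i * L (i - 1) - x (i - 1) * L i) * h₂
  -- Substituting `v (i+1) = a_i • v i - v (i-1)` leaves `a_i * det (v (i-1), v i) = a_i`.
  · obtain ⟨-, h₂⟩ := h.quiddity_mul hT hB i
    obtain ⟨h₁, -⟩ := h.quiddity_mul hT hB i
    have h₃ := h.vectorDet_succ hT hB (i - 1)
    rw [sub_add_cancel] at h₃
    simp only [vectorDet] at h₃ ⊢
    linear_combination (L (i - 1) : ℤ) * h₂ - x (i - 1) * h₁ + (quiddity T i : ℤ) * h₃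

theorem vectorDet_add (h : IsRealization n T L x) (p q : ℤ) :
    vectorDet L x p (q + n) - vectorDet L x p q = bridgingCount n T * L p * L q := by
  simp only [vectorDet, h.periodic, h.fst_periodic]
  ring

theorem vectorDet_add_add (h : IsRealization n T L x) (p q : ℤ) :
    vectorDet L x (p + n) (q + n) = vectorDet L x p q := by
  simp only [vectorDet, h.periodic, h.fst_periodic]
  ring

theorem label_val (h : IsRealization n T L x) (hn : 1 ≤ n) (p : ℤ) :
    L ((p : ZMod n).val : ℤ) = L p := by
  have : NeZero n := ⟨by omega⟩
  have hper : Function.Periodic L (n : ℤ) := h.periodic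
  rw [ZMod.val_intCast, Int.emod_def, mul_comm]
  exact hper.sub_int_mul_eq _

end IsRealization

end Strip

theorem mainTheorem5 (n : ℕ) (hn : 1 ≤ n) (T : Set Strip.Arc)
    (hT : Strip.IsPeriodicTriangulation n T) :
    (1 ≤ Strip.bridgingCount n T ∧ Strip.bridgingCount n T ≤ n) ∧
    (∃ m : ℤ → ℤ → ℤ, Frieze.IsAssociated T m) ∧
    ∃ label : ZMod n → ℕ,
      (∀ (c p : ℤ) (x : ℕ),
        Strip.IsLabel n T (.upper c) (.lower p) x ↔ x = label (p : ZMod n)) ∧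
      ∀ m : ℤ → ℤ → ℤ, Frieze.IsAssociated T m →
        Frieze.IsPeriodic n m ∧ Frieze.IsArithmetic n m ∧
        ∀ i k : ℤ, 1 ≤ k → k ≤ n →
          Frieze.commonDifference n m i k =
            (Strip.bridgingCount n T : ℤ) * label ((i - 1 : ℤ) : ZMod n) *
              label ((i + k - 2 : ℤ) : ZMod n) := by
  obtain ⟨hT, i₀, hi₀⟩ := hT
  have hper := hi₀.translate_mem
  have hB := Strip.hasBridging_of_translate hn hper hi₀.1
  obtain ⟨L, x, h⟩ := Strip.exists_isRealization hn hT hB hper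
  have hass := h.isAssociated hT hB
  have hL : Function.Periodic L (n : ℤ) := h.periodic
  refine ⟨⟨?_, ?_⟩, ⟨_, hass⟩, fun z => L (z.val : ℤ), fun c p y => ?_, fun m hm => ?_⟩
  · classical
    rw [Strip.bridgingCount_eq_card hn hper i₀, Nat.one_le_iff_ne_zero, Finset.card_ne_zero]
    exact ⟨0, by simpa using ⟨by omega, hi₀.1⟩⟩
  · classical
    rw [Strip.bridgingCount_eq_card hn hper i₀]
    exact (Finset.card_filter_le _ _).trans (Finset.card_range n).le
  · beta_reduce
    rw [h.label_val hn]
    exact Strip.isLabel_iff hn hT hB h.bridging h.additive c p y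
  · have heq : ∀ i j, i - 2 ≤ j → m i j = Strip.vectorDet L x (i - 1) (j + 1) := fun i j hij =>
      hm.1.eq_of_diag hass.1 (fun i => (hm.2 i).trans (hass.2 i).symm) hij
    -- For `1 ≤ k` the column `i + k - 3` is at least `i - 2`, so the determinant formula also
    -- covers the rows of zeros and ones.
    have hd : ∀ i k : ℤ, 1 ≤ k → Frieze.commonDifference n m i k =
        Strip.bridgingCount n T * L (i - 1) * L (i + k - 2) := by
      intro i k hk
      rw [Frieze.commonDifference, heq _ _ (by omega), heq _ _ (by omega), add_right_comm,
        h.vectorDet_add, show i + k - 3 + 1 = i + k - 2 by ring]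
    refine ⟨fun i j hij => ?_, fun i k hk _ l => ?_, fun i k hk _ => ?_⟩
    · rw [heq _ _ (by omega), heq _ _ (by omega), ← h.vectorDet_add_add (i - 1) (j + 1)]
      congr 1 <;> ring
    · have hl : (0 : ℤ) ≤ l * n := by positivity
      rw [hd i k hk, heq _ _ (by linarith), heq _ _ (by linarith),
        show i + k - 3 + ((l : ℤ) + 1) * n + 1 = i + k - 3 + l * n + 1 + n by ring,
        h.vectorDet_add, show i + k - 3 + (l : ℤ) * n + 1 = i + k - 2 + l * n by ring,
        hL.nat_mul l (i + k - 2)]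
    · beta_reduce
      rw [h.label_val hn, h.label_val hn]
      exact hd i k hk
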